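/- Let $d\ge 2$ and let $A$ be a real $d\times d$ matrix such that $L(\mathbf m)=A\mathbf m=(L_1(\mathbf m),\dots,L_d(\mathbf m))^T$, $\mathbf m\in\mathbb Z^d$, satisfies: (1) $\left|\prod_{j=1}^d L_j(\mathbf m)\right|\ge 1$ for all $\mathbf m\in\mathbb Z^d\setminus\{\mathbf 0\}$; (2) each parallelepiped $P$ with edges parallel to the coordinate axes and volume $|P|$ contains at most $|P|+1$ points of the lattice $A\mathbb Z^d$. For $a>1$ define the Frolov point set $$\mathcal F(a,A):=\left\{\frac{(A^{-1})^T\mathbf m}{a}:\ \mathbf m\in\mathbb Z^d\right\}\cap[0,1]^d .$$ Let $\mathcal B$ be the set of all boxes $[\mathbf x,\mathbf y)=\prod_{j=1}^d[x_j,y_j)$ with $\mathbf x,\mathbf y\in[0,1)^d$ and $x_j<y_j$ for all $j$. For $u>0$ let $h^1(\cdot,u)$ be the characteristic function of $[-u/2,u/2)$ and, for $r\ge 2$, let $h^r(\cdot,u):=h^{r-1}(\cdot,u)\ast h^1(\cdot,u)$ (convolution on $\mathbb R$). For $B\in\mathcal B$ written as $B=\prod_{j=1}^d[x_j^0-ru_j/2,\,x_j^0+ru_j/2)$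 put $h^r_B(\mathbf x):=\prod_{j=1}^d h^r(x_j-x_j^0,u_j)$. For a finite set $T=\{\xi^1,\dots,\xi^m\}\subset[0,1]^d$ and $V>0$ define the optimized $r$-smooth fixed volume discrepancy $$D^{r,o}(T,V):=\inf_{w_1,\dots,w_m\in\mathbb R}\ \sup_{B\in\mathcal B:\,\mathrm{vol}(B)=V}\left|\int_{\mathbb R^d} h^r_B(\mathbf x)\,d\mathbf x-\sum_{\mu=1}^m w_\mu h^r_B(\xi^\mu)\right|,$$ where the supremum over the empty set is $0$. Then for every integer $r\ge 2$ there exist constants $c(d,A,r)>0$ and $C(d,A,r)>0$ such that for all $a>1$ and all $V\ge V_0:=c(d,A,r)a^{-d}$ we have $$D^{r,o}(\mathcal F(a,A),V)\le C(d,A,r)\,a^{-rd}\,\bigl(\log(2V/V_0)\bigr)^{d-1}.$$ -/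

import Mathlib

open MeasureTheory
open scoped ENNReal

noncomputable section

namespace Frolov

/-- The lattice map `L(m) = A m` on integer (column) vectors. -/
def latticePoint {d : ℕ} (A : Matrix (Fin d) (Fin d) ℝ) (m : Fin d → ℤ) : Fin d → ℝ :=
  A.mulVec (fun j => (m j : ℝ))

/-- The two defining properties of the matrices used in the Frolov construction:
`|∏ L_j(m)| ≥ 1` for every nonzero integer vector `m`, and every axis-parallel parallelepiped `P`
contains at most `|P| + 1` points of the lattice. -/
structure IsFrolovMatrix {d : ℕ} (A : Matrix (Fin d) (Fin d) ℝ) : Prop where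
  one_le_abs_prod : ∀ m : Fin d → ℤ, m ≠ 0 → 1 ≤ |∏ j, latticePoint A m j|
  card_le : ∀ p q : Fin d → ℝ, (∀ j, p j < q j) → ∀ S : Finset (Fin d → ℤ),
    (∀ m ∈ S, latticePoint A m ∈ Set.Icc p q) → (S.card : ℝ) ≤ ∏ j, (q j - p j) + 1

/-- The points `(A⁻¹)ᵀ m / a`, `m ∈ ℤᵈ`, that lie in the closed cube `[0,1]ᵈ`. -/
def pointSet {d : ℕ} (a : ℝ) (A : Matrix (Fin d) (Fin d) ℝ) : Set (Fin d → ℝ) :=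
  Set.range (fun m : Fin d → ℤ => a⁻¹ • latticePoint (A⁻¹).transpose m) ∩ Set.Icc 0 1

theorem pointSet_finite {d : ℕ} (a : ℝ) (A : Matrix (Fin d) (Fin d) ℝ) :
    (pointSet a A).Finite := by
  by_cases ha : a = 0
  · refine (Set.finite_singleton (0 : Fin d → ℝ)).subset ?_
    rintro x ⟨⟨m, rfl⟩, -⟩
    simp [ha]
  by_cases hA : IsUnit A.det
  · obtain ⟨N, hN⟩ : ∃ N : ℕ, ∀ i, |a| * ∑ j, |A j i| ≤ N := by
      obtain ⟨N, hN⟩ := exists_nat_ge (∑ i, |a| * ∑ j, |A j i|)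
      refine ⟨N, fun i => le_trans ?_ hN⟩
      exact Finset.single_le_sum (f := fun i => |a| * ∑ j, |A j i|)
        (fun i _ => by positivity) (Finset.mem_univ i)
    refine ((Set.finite_Icc (fun _ : Fin d => -(N : ℤ)) (fun _ => (N : ℤ))).image
      (fun m : Fin d → ℤ => a⁻¹ • latticePoint (A⁻¹).transpose m)).subset ?_
    rintro x ⟨⟨m, rfl⟩, hx⟩
    refine ⟨m, ?_, rfl⟩
    set x := (fun m : Fin d → ℤ => a⁻¹ • latticePoint (A⁻¹).transpose m) m with hxd
    have hm : (fun j => (m j : ℝ)) = a • A.transpose.mulVec x := by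
      rw [hxd]
      simp only [latticePoint, Matrix.mulVec_smul, Matrix.mulVec_mulVec, smul_smul]
      rw [← Matrix.transpose_mul, Matrix.nonsing_inv_mul _ hA]
      simp [ha]
    have key : ∀ i, |(m i : ℝ)| ≤ N := by
      intro i
      have h1 := congrFun hm i
      simp only [Pi.smul_apply, smul_eq_mul, Matrix.mulVec, dotProduct,
        Matrix.transpose_apply] at h1
      rw [h1, abs_mul]
      refine le_trans (mul_le_mul_of_nonneg_left ?_ (abs_nonneg a)) (hN i)
      refine (Finset.abs_sum_le_sum_abs _ _).trans (Finset.sum_le_sum fun j _ => ?_)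
      rw [abs_mul]
      have h0 : 0 ≤ x j := hx.1 j
      have h2 : x j ≤ 1 := hx.2 j
      rw [abs_of_nonneg h0]
      exact mul_le_of_le_one_right (abs_nonneg _) h2
    constructor
    · intro i
      have := (abs_le.1 (key i)).1
      exact_mod_cast this
    · intro i
      have := (abs_le.1 (key i)).2
      exact_mod_cast this
  · refine (Set.finite_singleton (0 : Fin d → ℝ)).subset ?_
    rintro x ⟨⟨m, rfl⟩, -⟩
    simp [latticePoint, Matrix.nonsing_inv_apply_not_isUnit _ hA]

/-- The Frolov point set `F(a, A)`. -/
def frolovSet {d : ℕ} (a : ℝ) (A : Matrix (Fin d) (Fin d) ℝ) : Finset (Fin d → ℝ) :=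
  (pointSet_finite a A).toFinset

/-- The family of half-open axis-parallel boxes `[x, y)` with `x, y ∈ [0,1)ᵈ` and `x < y`
coordinate-wise. -/
structure Box (d : ℕ) where
  lower : Fin d → ℝ
  upper : Fin d → ℝ
  lower_mem : ∀ j, lower j ∈ Set.Ico (0 : ℝ) 1
  upper_mem : ∀ j, upper j ∈ Set.Ico (0 : ℝ) 1
  lower_lt_upper : ∀ j, lower j < upper j

namespace Box

variable {d : ℕ}

/-- The box as a set of points. -/
def toSet (B : Box d) : Set (Fin d → ℝ) :=
  Set.univ.pi fun j => Set.Ico (B.lower j) (B.upper j)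

/-- The volume of the box. -/
def vol (B : Box d) : ℝ := volume.real B.toSet

/-- The centre `x⁰` of the box. -/
def center (B : Box d) (j : Fin d) : ℝ := (B.lower j + B.upper j) / 2

/-- The parameter `u` in the representation `B = ∏ [x⁰_j - r u_j / 2, x⁰_j + r u_j / 2)`. -/
def width (B : Box d) (r : ℕ) (j : Fin d) : ℝ := (B.upper j - B.lower j) / r

end Box

/-- The univariate functions `h^r(·, u)`: `h^1(·, u)` is the characteristic function of
`[-u/2, u/2)` and `h^r(·, u) = h^{r-1}(·, u) ∗ h^1(·, u)` for `r ≥ 2`, so that `h^2(·, u)` is the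
hat function `x ↦ max (u - |x|) 0`. The value at `r = 0` is a placeholder. -/
def hat : ℕ → ℝ → ℝ → ℝ
  | 0, _, _ => 0
  | 1, u, x => Set.indicator (Set.Ico (-u / 2) (u / 2)) (fun _ => (1 : ℝ)) x
  | r + 2, u, x => ∫ y : ℝ, hat (r + 1) u (x - y) * hat 1 u y

/-- The function `h^r_B(x) = ∏ h^r(x_j - x⁰_j, u_j)` attached to a box `B`. -/
def boxHat {d : ℕ} (r : ℕ) (B : Box d) (x : Fin d → ℝ) : ℝ :=
  ∏ j, hat r (B.width r j) (x j - B.center j)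

/-- The optimized `r`-smooth fixed volume discrepancy `D^{r,o}(T, V)` of a finite point set `T`:
the infimum over all real weights on `T` of the supremum, over the boxes of volume `V`, of the
error of the weighted cubature formula for `h^r_B`. -/
def optDiscrepancy {d : ℕ} (r : ℕ) (T : Finset (Fin d → ℝ)) (V : ℝ) : ℝ≥0∞ :=
  ⨅ w : (Fin d → ℝ) → ℝ, ⨆ B : Box d, ⨆ _ : B.vol = V,
    ENNReal.ofReal |(∫ x : Fin d → ℝ, boxHat r B x) - ∑ ξ ∈ T, w ξ * boxHat r B ξ|

end Frolov

end

open MeasureTheory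
open scoped ENNReal

noncomputable section

namespace Frolov

variable {d : ℕ}

/-! Equal weights suffice. Let `M = a⁻¹ (A⁻¹)ᵀ` and give every node the weight `|det M|`. Since
`h^r_B` vanishes off the cube, the sum over the Frolov set is a sum over the whole lattice `M ℤᵈ`.
Poisson summation (`hasSum_integral_mFourier`) turns it into the sum of the Fourier transform of
`h^r_B` over the dual lattice `a A ℤᵈ`. The term at `0` is the integral, so the error is the sum
over `n ≠ 0` (`abs_integral_boxHat_sub_sum_le`).

The transform of `h^1(·, u)` at `y` is at most `min u (1 / (π |y|))`, and convolution raises this to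
the power `r`. With `b_j = π a u_j` the error is at most `(π a)^(-rd) ∑_{n ≠ 0} ∏ min (b_j, 1 / |L_j
n|)^r`, and `N = ∏ b_j` equals `V / V₀` for `c = (r / π)^d`.

It remains to bound this sum by a multiple of `log (2N)^(d-1)`. Each product is at most `1`, so `r =
2` is the worst case. After rescaling to `x_j = b_j L_j`, sort the points into dyadic blocks `|x_j|
~ 2^(k_j)`. By the norm bound nonempty blocks have `2^|k| ≳ N`; by the counting property each holds
`≲ 2^|k| / N` points, each contributing `≲ 4^(-|k|)`. The prefactor `N²` leaves `N ∑ 2^(-|k|)` over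
`2^|k| ≳ N`, where about `|k|^(d-1)` indices share the same `|k|`: this is the power of the
logarithm (`exists_sum_prod_min_sq_le`). -/

/-! ### Periodization and Poisson summation. -/

/-- The embedding of `ℤᵈ` into `ℝᵈ`. -/
def intVec (m : Fin d → ℤ) : Fin d → ℝ := fun i => (m i : ℝ)

/-- The projection of `ℝᵈ` onto the torus. -/
def toTorus (x : Fin d → ℝ) : UnitAddTorus (Fin d) := fun i => (x i : UnitAddCircle)

theorem isOpenQuotientMap_toTorus : IsOpenQuotientMap (toTorus : (Fin d → ℝ) → _) :=
  IsOpenQuotientMap.piMap fun _ => QuotientAddGroup.isOpenQuotientMap_mk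

theorem toTorus_add_intVec (x : Fin d → ℝ) (m : Fin d → ℤ) :
    toTorus (x + intVec m) = toTorus x := by
  funext i
  simp only [toTorus, intVec, Pi.add_apply]
  rw [AddCircle.coe_add]
  have : ((m i : ℝ) : UnitAddCircle) = 0 := by
    rw [AddCircle.coe_eq_zero_iff]
    exact ⟨m i, by simp⟩
  rw [this, add_zero]

theorem toTorus_eq_iff {x y : Fin d → ℝ} (h : toTorus x = toTorus y) :
    ∃ m : Fin d → ℤ, x = y + intVec m := by
  have : ∀ i, ∃ n : ℤ, x i = y i + n := by
    intro i
    have hi : (x i : UnitAddCircle) = (y i : UnitAddCircle) := congrFun h i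
    rw [← sub_eq_zero, ← AddCircle.coe_sub, AddCircle.coe_eq_zero_iff] at hi
    obtain ⟨n, hn⟩ := hi
    exact ⟨n, by rw [zsmul_eq_mul, mul_one] at hn; linarith⟩
  choose m hm using this
  exact ⟨m, funext hm⟩

/-- The sum of the translates of `g` by integer vectors. -/
def periodize (g : (Fin d → ℝ) → ℂ) (x : Fin d → ℝ) : ℂ := ∑ᶠ m : Fin d → ℤ, g (x + intVec m)

theorem periodize_add_intVec (g : (Fin d → ℝ) → ℂ) (x : Fin d → ℝ) (n : Fin d → ℤ) :
    periodize g (x + intVec n) = periodize g x := by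
  unfold periodize
  refine Eq.trans (finsum_congr fun m => ?_)
    (finsum_comp_equiv (Equiv.addLeft n) (f := fun m => g (x + intVec m)))
  congr 1
  funext i
  simp [intVec]
  ring

theorem mem_Icc_of_abs_add_le {R S : ℝ} {N : ℕ} (hN : R + S ≤ N) {x : Fin d → ℝ}
    (hx : ∀ i, |x i| ≤ S) {m : Fin d → ℤ} (h : ∀ i, |(x + intVec m) i| ≤ R) :
    m ∈ Finset.Icc (fun _ : Fin d => -(N : ℤ)) (fun _ => (N : ℤ)) := by
  rw [Finset.mem_Icc]
  have key : ∀ i, |(m i : ℝ)| ≤ N := fun i => by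
    have h1 := h i
    have h2 := hx i
    simp only [intVec, Pi.add_apply] at h1
    rw [abs_le] at *
    constructor <;> linarith
  constructor <;> intro i
  · have := (abs_le.1 (key i)).1
    exact_mod_cast this
  · have := (abs_le.1 (key i)).2
    exact_mod_cast this

theorem continuous_periodize {g : (Fin d → ℝ) → ℂ} (hg : Continuous g) {R : ℝ}
    (hR : ∀ x, g x ≠ 0 → ∀ i, |x i| ≤ R) : Continuous (periodize g) := by
  refine continuous_finsum (fun m => hg.comp (continuous_id.add continuous_const)) ?_
  intro x
  obtain ⟨N, hN⟩ := exists_nat_ge (R + (‖x‖ + 1))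
  refine ⟨Metric.ball x 1, Metric.ball_mem_nhds x one_pos, ?_⟩
  refine (Finset.finite_toSet (Finset.Icc (fun _ : Fin d => -(N : ℤ)) (fun _ => (N : ℤ)))).subset ?_
  rintro m ⟨y, hy, hyx⟩
  refine mem_Icc_of_abs_add_le hN (fun i => ?_) (hR _ hy)
  rw [Metric.mem_ball, dist_eq_norm] at hyx
  have h1 : ‖y‖ ≤ ‖x‖ + 1 := by
    have := norm_le_norm_add_norm_sub' y x
    linarith
  exact (norm_le_pi_norm y i).trans h1

theorem periodize_eq_sum {g : (Fin d → ℝ) → ℂ} {R S : ℝ}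
    (hR : ∀ x, g x ≠ 0 → ∀ i, |x i| ≤ R) {N : ℕ} (hN : R + S ≤ N) {x : Fin d → ℝ}
    (hx : ∀ i, |x i| ≤ S) :
    periodize g x =
      ∑ m ∈ Finset.Icc (fun _ : Fin d => -(N : ℤ)) (fun _ => (N : ℤ)), g (x + intVec m) :=
  finsum_eq_sum_of_support_subset _ fun _ hm => mem_Icc_of_abs_add_le hN hx (hR _ hm)

/-- The half-open unit cube. -/
def unitCube (d : ℕ) : Set (Fin d → ℝ) := {x | ∀ i, x i ∈ Set.Ioc (0 : ℝ) 1}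

theorem measurableSet_unitCube : MeasurableSet (unitCube d) :=
  MeasurableSet.univ_pi' fun _ => measurableSet_Ioc

theorem hasSum_integral_unitCube {f : (Fin d → ℝ) → ℂ} (hf : Integrable f) :
    HasSum (fun m : Fin d → ℤ => ∫ x in unitCube d, f (x + intVec m)) (∫ x, f x) := by
  have hmeas : ∀ m : Fin d → ℤ, MeasurableSet ((fun x => x + intVec (-m)) ⁻¹' unitCube d) :=
    fun m => measurableSet_unitCube.preimage (measurable_add_const _)
  have hdisj : Pairwise (Function.onFun Disjoint
      fun m : Fin d → ℤ => (fun x => x + intVec (-m)) ⁻¹' unitCube d) := by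
    intro m n hmn
    rw [Function.onFun, Set.disjoint_left]
    intro x hx hy
    apply hmn
    funext i
    have h1 := hx i
    have h2 := hy i
    simp only [intVec, Pi.add_apply, Pi.neg_apply, Set.mem_Ioc, Int.cast_neg] at h1 h2
    have h3 : (m i : ℝ) < n i + 1 := by linarith
    have h4 : (n i : ℝ) < m i + 1 := by linarith
    have h5 : m i < n i + 1 := by exact_mod_cast h3
    have h6 : n i < m i + 1 := by exact_mod_cast h4
    omega
  have hunion : (⋃ m : Fin d → ℤ, (fun x => x + intVec (-m)) ⁻¹' unitCube d) = Set.univ := by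
    refine Set.eq_univ_of_forall fun x => Set.mem_iUnion.2 ⟨fun i => ⌈x i⌉ - 1, fun i => ?_⟩
    simp only [intVec, Pi.add_apply, Pi.neg_apply, Set.mem_Ioc]
    push_cast
    constructor
    · linarith [Int.ceil_lt_add_one (x i)]
    · linarith [Int.le_ceil (x i)]
  have h := hasSum_integral_iUnion hmeas hdisj (hf.integrableOn (s := _))
  rw [hunion, setIntegral_univ] at h
  refine h.congr_fun fun m => ?_
  have hmp : MeasurePreserving (fun x : Fin d → ℝ => x + intVec (-m)) volume volume :=
    measurePreserving_add_right volume _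
  rw [← hmp.setIntegral_preimage_emb (measurableEmbedding_addRight _)]
  refine integral_congr_ae (Filter.Eventually.of_forall fun x => ?_)
  simp only
  congr 1
  funext i
  simp [intVec]

/-- Poisson summation over `ℤᵈ`. -/
theorem hasSum_integral_mFourier {g : (Fin d → ℝ) → ℂ} (hg : Continuous g) {R : ℝ}
    (hR : ∀ x, g x ≠ 0 → ∀ i, |x i| ≤ R)
    (hs : Summable fun n : Fin d → ℤ => ∫ x, UnitAddTorus.mFourier (-n) (toTorus x) * g x) :
    HasSum (fun n : Fin d → ℤ => ∫ x, UnitAddTorus.mFourier (-n) (toTorus x) * g x)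
      (∑ᶠ m : Fin d → ℤ, g (intVec m)) := by
  have hG := continuous_periodize hg hR
  have hcont : Continuous (toTorus : (Fin d → ℝ) → _) := isOpenQuotientMap_toTorus.continuous
  have hq : Topology.IsQuotientMap (⟨toTorus, hcont⟩ : C(Fin d → ℝ, UnitAddTorus (Fin d))) :=
    isOpenQuotientMap_toTorus.isQuotientMap
  have hfactor : Function.FactorsThrough (⟨periodize g, hG⟩ : C(Fin d → ℝ, ℂ))
      (⟨toTorus, hcont⟩ : C(Fin d → ℝ, UnitAddTorus (Fin d))) := by
    intro x y (hxy : toTorus x = toTorus y)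
    obtain ⟨m, rfl⟩ := toTorus_eq_iff hxy
    exact periodize_add_intVec g y m
  let F : C(UnitAddTorus (Fin d), ℂ) := hq.lift ⟨periodize g, hG⟩ hfactor
  have hF : ∀ x, F (toTorus x) = periodize g x := fun x =>
    congrArg (fun f => f x) (hq.lift_comp ⟨periodize g, hG⟩ hfactor)
  have hcompact : HasCompactSupport g := by
    refine HasCompactSupport.intro (K := Set.Icc (fun _ => -R) (fun _ => R)) isCompact_Icc ?_
    intro x hx
    by_contra h
    exact hx ⟨fun i => (abs_le.1 (hR x h i)).1, fun i => (abs_le.1 (hR x h i)).2⟩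
  have hcoeff : ∀ n, UnitAddTorus.mFourierCoeff F n =
      ∫ x, UnitAddTorus.mFourier (-n) (toTorus x) * g x := by
    intro n
    set f : (Fin d → ℝ) → ℂ := fun x => UnitAddTorus.mFourier (-n) (toTorus x) * g x with hf
    have hfc : Continuous f := ((UnitAddTorus.mFourier (-n)).continuous.comp hcont).mul hg
    have hfi : Integrable f := hfc.integrable_of_hasCompactSupport hcompact.mul_left
    have hfR : ∀ x, f x ≠ 0 → ∀ i, |x i| ≤ R := fun x hx => hR x (right_ne_zero_of_mul hx)
    obtain ⟨N, hN⟩ := exists_nat_ge (R + 1)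
    have hcube : ∀ x ∈ unitCube d, ∀ i, |x i| ≤ 1 := fun x hx i => by
      rw [abs_of_pos (hx i).1]; exact (hx i).2
    have h0 := hasSum_integral_unitCube hfi
    -- Compact support leaves finitely many translates, so the sum over tiles can be exchanged with
    -- the integral over the cube.
    have h1 : ∀ m ∉ Finset.Icc (fun _ : Fin d => -(N : ℤ)) (fun _ => (N : ℤ)),
        ∫ x in unitCube d, f (x + intVec m) = 0 := by
      intro m hm
      refine setIntegral_eq_zero_of_forall_eq_zero fun x hx => ?_
      by_contra h
      exact hm (mem_Icc_of_abs_add_le hN (hcube x hx) (hfR _ h))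
    rw [← h0.tsum_eq, tsum_eq_sum h1, ← integral_finsetSum,
      UnitAddTorus.mFourierCoeff_eq_integral _ _ 0]
    · rw [show {x : Fin d → ℝ | ∀ i, x i ∈ Set.Ioc ((0 : Fin d → ℝ) i) ((0 : Fin d → ℝ) i + 1)} =
        unitCube d by simp [unitCube]]
      refine setIntegral_congr_fun (μ := volume) measurableSet_unitCube fun x hx => ?_
      change UnitAddTorus.mFourier (-n) (toTorus x) • F (toTorus x) = _
      rw [hF, periodize_eq_sum hR hN (hcube x hx), smul_eq_mul, Finset.mul_sum]
      simp only [hf, toTorus_add_intVec]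
    · intro m _
      exact (hfi.comp_add_right (intVec m)).integrableOn
  have hsum : Summable (UnitAddTorus.mFourierCoeff F) := by
    rw [show UnitAddTorus.mFourierCoeff F = _ from funext hcoeff]; exact hs
  -- Absolutely summable coefficients make the Fourier series of a continuous function converge
  -- pointwise; at `0` all characters equal `1`.
  have h := UnitAddTorus.hasSum_mFourier_series_apply_of_summable hsum (toTorus 0)
  rw [hF] at h
  simp only [hcoeff] at h
  have h2 : periodize g 0 = ∑ᶠ m : Fin d → ℤ, g (intVec m) := by simp [periodize]
  rw [h2] at h
  convert h using 2 with n
  have : UnitAddTorus.mFourier n (toTorus 0) = 1 := by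
    simp [UnitAddTorus.mFourier, toTorus]
  rw [this, smul_eq_mul, mul_one]

/-! ### The splines `h^r` and their Fourier transforms. -/

theorem hat_add_two_eq_convolution (r : ℕ) (u : ℝ) :
    hat (r + 2) u =
      convolution (hat 1 u) (hat (r + 1) u) (ContinuousLinearMap.mul ℝ ℝ) volume := by
  funext x
  simp only [hat, convolution, ContinuousLinearMap.mul_apply']
  exact integral_congr_ae (Filter.Eventually.of_forall fun t => mul_comm _ _)

theorem hat_one (u : ℝ) :
    hat 1 u = Set.indicator (Set.Ico (-u / 2) (u / 2)) (fun _ => (1 : ℝ)) := by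
  funext x
  rw [hat]

theorem integrable_hat_one (u : ℝ) : Integrable (hat 1 u) := by
  rw [hat_one, integrable_indicator_iff measurableSet_Ico]
  exact integrableOn_const (by simp)

theorem integrable_hat (r : ℕ) (u : ℝ) : Integrable (hat (r + 1) u) := by
  induction r with
  | zero => exact integrable_hat_one u
  | succ r ih =>
    rw [hat_add_two_eq_convolution]
    exact (integrable_hat_one u).integrable_convolution _ ih

theorem hat_add_two_eq_intervalIntegral (r : ℕ) {u : ℝ} (hu : 0 ≤ u) (x : ℝ) :
    hat (r + 2) u x = ∫ t in (x - u / 2)..(x + u / 2), hat (r + 1) u t := by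
  have h1 : hat (r + 2) u x =
      ∫ y, Set.indicator (Set.Ico (-u / 2) (u / 2)) (fun y => hat (r + 1) u (x - y)) y := by
    rw [hat]
    refine integral_congr_ae (Filter.Eventually.of_forall fun y => ?_)
    simp only [hat_one, Set.indicator]
    split_ifs <;> simp
  rw [h1, integral_indicator measurableSet_Ico, integral_Ico_eq_integral_Ioc,
    ← intervalIntegral.integral_of_le (by linarith),
    intervalIntegral.integral_comp_sub_left (fun t => hat (r + 1) u t)]
  congr 1
  ring

/-- From `r = 2` on, `h^r` is the integral of an integrable function over a sliding window. For `r =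
1` it jumps. -/
theorem continuous_hat {r : ℕ} (hr : 2 ≤ r) {u : ℝ} (hu : 0 ≤ u) : Continuous (hat r u) := by
  obtain ⟨r, rfl⟩ := Nat.exists_eq_add_of_le' hr
  have hint : ∀ a b, IntervalIntegrable (hat (r + 1) u) volume a b :=
    fun a b => (integrable_hat r u).intervalIntegrable
  have h : hat (r + 2) u = fun x => (∫ t in (0 : ℝ)..(x + u / 2), hat (r + 1) u t) -
      ∫ t in (0 : ℝ)..(x - u / 2), hat (r + 1) u t := by
    funext x
    rw [hat_add_two_eq_intervalIntegral r hu, intervalIntegral.integral_interval_sub_left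
      (hint _ _) (hint _ _)]
  rw [h]
  have hc := intervalIntegral.continuous_primitive hint 0
  exact (hc.comp (continuous_id.add continuous_const)).sub
    (hc.comp (continuous_id.sub continuous_const))

theorem abs_le_of_hat_ne_zero (r : ℕ) (u : ℝ) {x : ℝ} (hx : hat (r + 1) u x ≠ 0) :
    |x| ≤ (r + 1 : ℕ) * u / 2 := by
  have h1 : ∀ {x}, hat 1 u x ≠ 0 → |x| ≤ u / 2 := by
    intro x hx
    rw [hat_one] at hx
    have := Set.mem_of_indicator_ne_zero hx
    rw [abs_le]
    constructor <;> linarith [this.1, this.2]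
  induction r generalizing x with
  | zero => simpa using h1 hx
  | succ r ih =>
    by_contra! h
    refine hx ?_
    rw [hat]
    refine integral_eq_zero_of_ae (Filter.Eventually.of_forall fun y => ?_)
    by_contra hy
    have h2 := ih (left_ne_zero_of_mul hy)
    have h3 := h1 (right_ne_zero_of_mul hy)
    have h4 : |x| ≤ |x - y| + |y| := by simpa using abs_add_le (x - y) y
    push_cast at *
    linarith

/-- The character `x ↦ exp (-2πi y x)` of the real line. -/
def expChar (y x : ℝ) : ℂ := Complex.exp ((-(2 * Real.pi * y) : ℝ) * Complex.I * x)

theorem expChar_add (y x x' : ℝ) : expChar y (x + x') = expChar y x * expChar y x' := by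
  rw [expChar, expChar, expChar, ← Complex.exp_add]
  congr 1
  push_cast
  ring

theorem norm_expChar (y x : ℝ) : ‖expChar y x‖ = 1 := by
  rw [expChar, show ((-(2 * Real.pi * y) : ℝ) : ℂ) * Complex.I * x =
    ((-(2 * Real.pi * y) * x : ℝ) : ℂ) * Complex.I by push_cast; ring]
  exact Complex.norm_exp_ofReal_mul_I _

theorem continuous_expChar (y : ℝ) : Continuous (expChar y) := by
  unfold expChar
  fun_prop

theorem integrable_hat_mul_expChar (r : ℕ) (u y : ℝ) :
    Integrable fun x => (hat (r + 1) u x : ℂ) * expChar y x := by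
  refine (integrable_hat r u).ofReal.mul_bdd (c := 1)
    (continuous_expChar y).aestronglyMeasurable ?_
  exact Filter.Eventually.of_forall fun x => (norm_expChar y x).le

/-- A character is multiplicative, so twisting by it commutes with convolution, and the integral of
a convolution is the product of the integrals. -/
theorem integral_hat_mul_expChar (r : ℕ) (u y : ℝ) :
    ∫ x, (hat (r + 1) u x : ℂ) * expChar y x =
      (∫ x, (hat 1 u x : ℂ) * expChar y x) ^ (r + 1) := by
  induction r with
  | zero => simp
  | succ r ih =>
    rw [pow_succ', ← ih]
    have h := integral_convolution (ContinuousLinearMap.mul ℝ ℂ)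
      (integrable_hat_mul_expChar 0 u y) (integrable_hat_mul_expChar r u y)
    rw [ContinuousLinearMap.mul_apply'] at h
    rw [← h]
    refine integral_congr_ae (Filter.Eventually.of_forall fun x => ?_)
    simp only [convolution, ContinuousLinearMap.mul_apply']
    rw [hat, ← integral_complex_ofReal, ← integral_mul_const]
    refine integral_congr_ae (Filter.Eventually.of_forall fun t => ?_)
    have : expChar y x = expChar y t * expChar y (x - t) := by
      rw [← expChar_add]; congr 1; ring
    simp only [this]
    push_cast
    ring

/-- The first bound is the length of the interval; the second comes from the antiderivative, whose
numerator has modulus at most `2` over `2π|y|`. -/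
theorem norm_integral_hat_one_le {u y : ℝ} (hu : 0 ≤ u) (hy : y ≠ 0) :
    ‖∫ x, (hat 1 u x : ℂ) * expChar y x‖ ≤ min u (1 / (Real.pi * |y|)) := by
  have h1 : ∫ x, (hat 1 u x : ℂ) * expChar y x = ∫ x in (-u / 2)..(u / 2), expChar y x := by
    rw [intervalIntegral.integral_of_le (by linarith), ← integral_Ico_eq_integral_Ioc,
      ← integral_indicator measurableSet_Ico]
    refine integral_congr_ae (Filter.Eventually.of_forall fun x => ?_)
    simp only [hat_one, Set.indicator]
    split_ifs <;> simp
  rw [h1]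
  refine le_min ?_ ?_
  · refine (intervalIntegral.norm_integral_le_of_norm_le_const
      (fun x _ => (norm_expChar y x).le)).trans ?_
    rw [one_mul, abs_of_nonneg (by linarith)]
    linarith
  · have hc : ((-(2 * Real.pi * y) : ℝ) : ℂ) * Complex.I ≠ 0 := by
      refine mul_ne_zero ?_ Complex.I_ne_zero
      rw [Complex.ofReal_ne_zero]
      have := Real.pi_pos.ne'
      simp [this, hy]
    have h2 : ∫ x in (-u / 2)..(u / 2), expChar y x =
        (expChar y (u / 2) - expChar y (-u / 2)) / (((-(2 * Real.pi * y) : ℝ) : ℂ) * Complex.I) :=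
      integral_exp_mul_complex hc
    rw [h2, norm_div]
    have h3 : ‖((-(2 * Real.pi * y) : ℝ) : ℂ) * Complex.I‖ = 2 * (Real.pi * |y|) := by
      rw [norm_mul, Complex.norm_I, mul_one, Complex.norm_real, Real.norm_eq_abs, abs_neg,
        abs_mul, abs_of_pos (by positivity : 0 < 2 * Real.pi)]
      ring
    have h4 : ‖expChar y (u / 2) - expChar y (-u / 2)‖ ≤ 2 := by
      refine (norm_sub_le _ _).trans ?_
      rw [norm_expChar, norm_expChar]
      norm_num
    rw [h3, ← mul_div_mul_left 1 (Real.pi * |y|) two_ne_zero, mul_one]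
    gcongr

theorem norm_integral_hat_mul_expChar_le {r : ℕ} (hr : 1 ≤ r) {u y : ℝ} (hu : 0 ≤ u) (hy : y ≠ 0)
    (c : ℝ) : ‖∫ x, (hat r u (x - c) : ℂ) * expChar y x‖ ≤ (min u (1 / (Real.pi * |y|))) ^ r := by
  obtain ⟨r, rfl⟩ := Nat.exists_eq_add_of_le' hr
  have h : ∫ x, (hat (r + 1) u (x - c) : ℂ) * expChar y x =
      (∫ x, (hat (r + 1) u x : ℂ) * expChar y x) * expChar y c := by
    rw [← integral_mul_const,
      ← integral_sub_right_eq_self (fun x => (hat (r + 1) u x : ℂ) * expChar y x * expChar y c) c]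
    refine integral_congr_ae (Filter.Eventually.of_forall fun x => ?_)
    simp only
    rw [mul_assoc, ← expChar_add, sub_add_cancel]
  rw [h, norm_mul, norm_expChar, mul_one, integral_hat_mul_expChar, norm_pow]
  exact pow_le_pow_left₀ (norm_nonneg _) (norm_integral_hat_one_le hu hy) _

/-! ### The box functions `h^r_B`. -/

theorem Box.width_pos (B : Box d) {r : ℕ} (hr : 1 ≤ r) (j : Fin d) : 0 < B.width r j := by
  have := B.lower_lt_upper j
  have h : (0 : ℝ) < r := by exact_mod_cast hr
  exact div_pos (by linarith) h

theorem Box.vol_eq (B : Box d) {r : ℕ} (hr : 1 ≤ r) : B.vol = r ^ d * ∏ j, B.width r j := by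
  have h : (r : ℝ) ≠ 0 := by positivity
  have h1 : B.vol = ∏ j, (B.upper j - B.lower j) := by
    rw [Box.vol, Measure.real, Box.toSet, Real.volume_pi_Ico, ENNReal.toReal_prod]
    refine Finset.prod_congr rfl fun j _ => ENNReal.toReal_ofReal ?_
    linarith [B.lower_lt_upper j]
  rw [h1]
  simp only [Box.width, Finset.prod_div_distrib, Finset.prod_const, Finset.card_univ,
    Fintype.card_fin]
  field_simp

theorem continuous_boxHat {r : ℕ} (hr : 2 ≤ r) (B : Box d) : Continuous (boxHat r B) := by
  refine continuous_finsetProd _ fun j _ => ?_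
  exact (continuous_hat hr (B.width_pos (by omega) j).le).comp
    ((continuous_apply j).sub continuous_const)

theorem mem_Icc_of_boxHat_ne_zero {r : ℕ} (hr : 1 ≤ r) (B : Box d) {x : Fin d → ℝ}
    (hx : boxHat r B x ≠ 0) : x ∈ Set.Icc (0 : Fin d → ℝ) 1 := by
  obtain ⟨r, rfl⟩ := Nat.exists_eq_add_of_le' hr
  have key : ∀ j, 0 ≤ x j ∧ x j ≤ 1 := by
    intro j
    have h1 := abs_le_of_hat_ne_zero r _ (Finset.prod_ne_zero_iff.1 hx j (Finset.mem_univ j))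
    have h2 : ((r + 1 : ℕ) : ℝ) * B.width (r + 1) j = B.upper j - B.lower j := by
      have : ((r + 1 : ℕ) : ℝ) ≠ 0 := by positivity
      rw [Box.width]
      field_simp
    rw [h2, abs_le, Box.center] at h1
    constructor
    · linarith [(B.lower_mem j).1]
    · linarith [(B.upper_mem j).2]
  exact ⟨fun j => (key j).1, fun j => (key j).2⟩

theorem norm_integral_boxHat_mul_le {r : ℕ} (hr : 1 ≤ r) (B : Box d) {y : Fin d → ℝ}
    (hy : ∀ j, y j ≠ 0) :
    ‖∫ x : Fin d → ℝ, (boxHat r B x : ℂ) * ∏ j, expChar (y j) (x j)‖ ≤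
      ∏ j, (min (B.width r j) (1 / (Real.pi * |y j|))) ^ r := by
  have h : ∫ x : Fin d → ℝ, (boxHat r B x : ℂ) * ∏ j, expChar (y j) (x j) =
      ∏ j, ∫ x : ℝ, (hat r (B.width r j) (x - B.center j) : ℂ) * expChar (y j) x := by
    rw [← integral_fintype_prod_volume_eq_prod
      (f := fun j (x : ℝ) => (hat r (B.width r j) (x - B.center j) : ℂ) * expChar (y j) x)]
    refine integral_congr_ae (Filter.Eventually.of_forall fun x => ?_)
    simp only [boxHat, Complex.ofReal_prod, Finset.prod_mul_distrib]
  rw [h, norm_prod]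
  exact Finset.prod_le_prod (fun _ _ => norm_nonneg _) fun j _ =>
    norm_integral_hat_mul_expChar_le hr (B.width_pos hr j).le (hy j) _

/-! ### Dyadic sums. -/

theorem summable_succ_pow_mul_geometric (n : ℕ) :
    Summable fun j : ℕ => ((j : ℝ) + 1) ^ n * (1 / 2 : ℝ) ^ j := by
  have h := (summable_nat_add_iff 1).2
    (summable_pow_mul_geometric_of_norm_lt_one n (r := (1 / 2 : ℝ)) (by norm_num))
  refine (h.mul_left 2).congr fun j => ?_
  push_cast
  ring

/-- The last `n` coordinates lie in `0..t` and determine the first one. -/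
theorem card_filter_sum_eq_le {n : ℕ} (s : Finset (Fin (n + 1) → ℕ)) (t : ℕ) :
    (s.filter fun k => ∑ i, k i = t).card ≤ (t + 1) ^ n := by
  have h : (Fintype.piFinset fun _ : Fin n => Finset.range (t + 1)).card = (t + 1) ^ n := by
    simp
  rw [← h]
  refine Finset.card_le_card_of_injOn (fun k i => k i.succ) ?_ ?_
  · intro k hk
    have hk : ∑ i, k i = t := (Finset.mem_filter.1 hk).2
    refine Fintype.mem_piFinset.2 fun i => Finset.mem_range.2 ?_
    have := Finset.single_le_sum (f := k) (fun _ _ => Nat.zero_le _) (Finset.mem_univ i.succ)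
    change k i.succ < t + 1
    omega
  · intro k hk l hl hkl
    have hk : ∑ i, k i = t := (Finset.mem_filter.1 hk).2
    have hl : ∑ i, l i = t := (Finset.mem_filter.1 hl).2
    rw [Fin.sum_univ_succ] at hk hl
    have h1 : ∀ i : Fin n, k i.succ = l i.succ := fun i => congrFun hkl i
    simp only [h1] at hk
    funext i
    refine Fin.cases ?_ h1 i
    omega

/-- Tail sums of the multi-indexed geometric series with ratio `1 / 2`. -/
theorem exists_sum_half_pow_le (n : ℕ) : ∃ C : ℝ, 0 < C ∧ ∀ (K : ℕ) (s : Finset (Fin (n + 1) → ℕ)),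
    (∀ k ∈ s, K ≤ ∑ i, k i) →
      ∑ k ∈ s, (1 / 2 : ℝ) ^ (∑ i, k i) ≤ C * ((K : ℝ) + 1) ^ n * (1 / 2) ^ K := by
  set F : ℕ → ℝ := fun j => ((j : ℝ) + 1) ^ n * (1 / 2 : ℝ) ^ j with hF
  have hsum : Summable F := summable_succ_pow_mul_geometric n
  have hF0 : ∀ j, 0 ≤ F j := fun j => by positivity
  refine ⟨∑' j, F j, hsum.tsum_pos hF0 0 (by simp [hF]), fun K s hs => ?_⟩
  set T := s.image fun k => ∑ i, k i with hT
  have hTK : ∀ t ∈ T, K ≤ t := by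
    intro t ht
    obtain ⟨k, hk, rfl⟩ := Finset.mem_image.1 ht
    exact hs k hk
  calc ∑ k ∈ s, (1 / 2 : ℝ) ^ (∑ i, k i)
      = ∑ t ∈ T, ∑ k ∈ s with ∑ i, k i = t, (1 / 2 : ℝ) ^ (∑ i, k i) :=
        (Finset.sum_fiberwise_of_maps_to (fun k hk => Finset.mem_image_of_mem _ hk) _).symm
    _ ≤ ∑ t ∈ T, ((K : ℝ) + 1) ^ n * (1 / 2) ^ K * F (t - K) := by
        refine Finset.sum_le_sum fun t ht => ?_
        obtain ⟨j, rfl⟩ := Nat.exists_eq_add_of_le (hTK t ht)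
        have h1 : ∑ k ∈ s with ∑ i, k i = K + j, (1 / 2 : ℝ) ^ (∑ i, k i) =
            (s.filter fun k => ∑ i, k i = K + j).card * (1 / 2 : ℝ) ^ (K + j) := by
          rw [← nsmul_eq_mul]
          exact Finset.sum_eq_card_nsmul fun k hk => by rw [(Finset.mem_filter.1 hk).2]
        have h2 : ((s.filter fun k => ∑ i, k i = K + j).card : ℝ) ≤ ((K + j : ℕ) + 1 : ℝ) ^ n := by
          exact_mod_cast card_filter_sum_eq_le s (K + j)
        -- `K + j + 1 ≤ (K + 1)(j + 1)` separates the dependence on `K` from a convergent series in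
        -- `j`.
        have h3 : ((K + j : ℕ) + 1 : ℝ) ^ n ≤ (((K : ℝ) + 1) * ((j : ℝ) + 1)) ^ n := by
          refine pow_le_pow_left₀ (by positivity) ?_ n
          push_cast
          have : (0 : ℝ) ≤ K * j := by positivity
          linarith
        rw [h1, Nat.add_sub_cancel_left]
        calc _ ≤ (((K : ℝ) + 1) * ((j : ℝ) + 1)) ^ n * (1 / 2 : ℝ) ^ (K + j) :=
              mul_le_mul_of_nonneg_right (h2.trans h3) (by positivity)
          _ = _ := by rw [hF, mul_pow, pow_add]; ring
    _ = ((K : ℝ) + 1) ^ n * (1 / 2) ^ K * ∑ j ∈ T.image (· - K), F j := by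
        rw [← Finset.mul_sum, Finset.sum_image (s := T) (g := (· - K)) (f := F)]
        intro t ht t' ht' h
        have h1 := hTK t ht
        have h2 := hTK t' ht'
        simp only at h
        omega
    _ ≤ ((K : ℝ) + 1) ^ n * (1 / 2) ^ K * ∑' j, F j := by
        gcongr
        exact hsum.sum_le_tsum _ fun j _ => hF0 j
    _ = _ := by ring

/-- A family of points with `∏ |x_j| ≥ N` of which every centred box of volume `P` contains at most
`P / N + 1` has small dyadic sums. -/
theorem exists_sum_prod_min_sq_le (n : ℕ) : ∃ C : ℝ, 0 < C ∧
    ∀ (ι : Type) (x : ι → Fin (n + 1) → ℝ) (N : ℝ), 1 ≤ N → (∀ i, N ≤ ∏ j, |x i j|) →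
      (∀ R : Fin (n + 1) → ℝ, (∀ j, 0 < R j) → ∀ S : Finset ι,
        (∀ i ∈ S, ∀ j, |x i j| ≤ R j) → (S.card : ℝ) ≤ (∏ j, (2 * R j)) / N + 1) →
      ∀ S : Finset ι, N ^ 2 * ∑ i ∈ S, ∏ j, (min 1 (1 / |x i j|)) ^ 2 ≤
        C * Real.log (2 * N) ^ n := by
  obtain ⟨C, hC, hCs⟩ := exists_sum_half_pow_le n
  have hlog2 : 0 < Real.log 2 := Real.log_pos one_lt_two
  set D : ℝ := 4 ^ (n + 1) + 2 ^ (n + 1) with hD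
  have hDpos : 0 < D := by positivity
  -- `D` comes from counting a block, `C` from the geometric tail, `2 ^ (n + 1) * 2` from comparing
  -- the tail with `1 / N`, and the logarithm from `K + 1 ≤ log₂ (2N)`.
  refine ⟨D * C * 2 ^ (n + 1) * 2 / Real.log 2 ^ n, by positivity, ?_⟩
  intro ι x N hN hx hcount S
  have hNpos : 0 < N := by linarith
  -- The maximum with `1` puts all coordinates below `1` into the block of exponent `0`.
  have hexp : ∀ i j, ∃ k : ℕ, (2 : ℝ) ^ k ≤ max 1 |x i j| ∧ max 1 |x i j| < 2 ^ (k + 1) :=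
    fun i j => exists_nat_pow_near (le_max_left _ _) one_lt_two
  choose κ hκ using hexp
  obtain ⟨K, hK1, hK2⟩ := exists_nat_pow_near hN (one_lt_two (α := ℝ))
  have hle : ∀ i j, |x i j| ≤ 2 ^ (κ i j + 1) := fun i j =>
    (le_max_right _ _).trans (hκ i j).2.le
  have hxpos : ∀ i j, 0 < |x i j| := by
    intro i j
    rw [abs_pos]
    intro h
    have := hx i
    rw [Finset.prod_eq_zero (Finset.mem_univ j) (by rw [h, abs_zero])] at this
    linarith
  have hNle : ∀ i, N ≤ 2 ^ (n + 1) * 2 ^ (∑ j, κ i j) := by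
    intro i
    calc N ≤ ∏ j, |x i j| := hx i
      _ ≤ ∏ j, 2 ^ (κ i j + 1) := Finset.prod_le_prod (fun _ _ => abs_nonneg _) fun j _ => hle i j
      _ = _ := by
        rw [Finset.prod_pow_eq_pow_sum, Finset.sum_add_distrib, pow_add]
        simp [mul_comm]
  have hterm : ∀ i, ∏ j, (min 1 (1 / |x i j|)) ^ 2 ≤ (1 / 2 : ℝ) ^ (∑ j, κ i j) *
      (1 / 2 : ℝ) ^ (∑ j, κ i j) := by
    intro i
    rw [← Finset.prod_pow_eq_pow_sum, ← Finset.prod_mul_distrib]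
    refine Finset.prod_le_prod (fun _ _ => by positivity) fun j _ => ?_
    have h1 : min 1 (1 / |x i j|) ≤ (1 / 2 : ℝ) ^ κ i j := by
      rw [one_div_pow]
      rcases le_max_iff.1 (hκ i j).1 with h | h
      · refine (min_le_left _ _).trans ?_
        rw [le_div_iff₀ (by positivity), one_mul]
        exact h
      · exact (min_le_right _ _).trans (one_div_le_one_div_of_le (by positivity) h)
    rw [← sq]
    have := hxpos i j
    exact pow_le_pow_left₀ (by positivity) h1 2
  have hcard : ∀ k ∈ S.image κ, ((S.filter fun i => κ i = k).card : ℝ) ≤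
      D * 2 ^ (∑ j, k j) / N := by
    intro k hk
    obtain ⟨i, hi, rfl⟩ := Finset.mem_image.1 hk
    have h1 := hcount (fun j => 2 ^ (κ i j + 1)) (fun j => by positivity)
      (S.filter fun i' => κ i' = κ i) (fun i' hi' j => by
        rw [← (Finset.mem_filter.1 hi').2]; exact hle i' j)
    have h2 : ∏ j, (2 * (2 : ℝ) ^ (κ i j + 1)) = 4 ^ (n + 1) * 2 ^ (∑ j, κ i j) := by
      rw [← Finset.prod_pow_eq_pow_sum]
      rw [show (4 : ℝ) ^ (n + 1) = ∏ _j : Fin (n + 1), (4 : ℝ) by simp,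
        ← Finset.prod_mul_distrib]
      refine Finset.prod_congr rfl fun j _ => ?_
      rw [pow_succ]; ring
    -- The block contains `x i`, so its volume is comparable to at least `N`; this absorbs the `+ 1`
    -- of the counting bound.
    have h3 : 1 ≤ 2 ^ (n + 1) * 2 ^ (∑ j, κ i j) / N := by
      rw [le_div_iff₀ hNpos, one_mul]
      exact hNle i
    rw [h2] at h1
    refine h1.trans ?_
    rw [hD, add_mul, add_div]
    linarith
  -- The subtraction is truncated at `0`, which is harmless: the bound is then trivial.
  have hKk : ∀ k ∈ S.image κ, K - (n + 1) ≤ ∑ j, k j := by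
    intro k hk
    obtain ⟨i, hi, rfl⟩ := Finset.mem_image.1 hk
    have h1 : (2 : ℝ) ^ K ≤ 2 ^ (n + 1 + ∑ j, κ i j) := by
      rw [pow_add]; exact hK1.trans (hNle i)
    have h2 := (pow_le_pow_iff_right₀ (one_lt_two (α := ℝ))).1 h1
    omega
  have hsum := hCs (K - (n + 1)) (S.image κ) hKk
  have hKlog : (K : ℝ) + 1 ≤ Real.log (2 * N) / Real.log 2 := by
    rw [le_div_iff₀ hlog2]
    have h1 : (2 : ℝ) ^ (K + 1) ≤ 2 * N := by rw [pow_succ]; linarith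
    have h2 := Real.log_le_log (by positivity) h1
    rw [Real.log_pow] at h2
    push_cast at h2
    exact h2
  have hKpow : N * (1 / 2 : ℝ) ^ (K - (n + 1)) ≤ 2 ^ (n + 1) * 2 := by
    have h1 : (2 : ℝ) ^ K ≤ 2 ^ (n + 1) * 2 ^ (K - (n + 1)) := by
      rw [← pow_add]
      exact pow_le_pow_right₀ one_le_two (by omega)
    rw [one_div_pow, mul_one_div, div_le_iff₀ (by positivity)]
    rw [pow_succ] at hK2
    linarith
  have hKsub : ((K - (n + 1) : ℕ) : ℝ) + 1 ≤ (K : ℝ) + 1 := by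
    have : ((K - (n + 1) : ℕ) : ℝ) ≤ K := by exact_mod_cast Nat.sub_le _ _
    linarith
  calc N ^ 2 * ∑ i ∈ S, ∏ j, (min 1 (1 / |x i j|)) ^ 2
      ≤ N ^ 2 * ∑ i ∈ S, (1 / 2 : ℝ) ^ (∑ j, κ i j) * (1 / 2 : ℝ) ^ (∑ j, κ i j) := by
        gcongr with i hi
        exact hterm i
    _ = N ^ 2 * ∑ k ∈ S.image κ, ∑ i ∈ S with κ i = k,
          (1 / 2 : ℝ) ^ (∑ j, κ i j) * (1 / 2 : ℝ) ^ (∑ j, κ i j) := by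
        rw [Finset.sum_fiberwise_of_maps_to fun i hi => Finset.mem_image_of_mem _ hi]
    _ ≤ N ^ 2 * ∑ k ∈ S.image κ, D / N * (1 / 2 : ℝ) ^ (∑ j, k j) := by
        refine mul_le_mul_of_nonneg_left (Finset.sum_le_sum fun k hk => ?_) (by positivity)
        have h1 : ∑ i ∈ S with κ i = k, (1 / 2 : ℝ) ^ (∑ j, κ i j) * (1 / 2 : ℝ) ^ (∑ j, κ i j) =
            (S.filter fun i => κ i = k).card *
              ((1 / 2 : ℝ) ^ (∑ j, k j) * (1 / 2 : ℝ) ^ (∑ j, k j)) := by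
          rw [← nsmul_eq_mul]
          exact Finset.sum_eq_card_nsmul fun i hi => by rw [(Finset.mem_filter.1 hi).2]
        rw [h1]
        refine (mul_le_mul_of_nonneg_right (hcard k hk) (by positivity)).trans (le_of_eq ?_)
        rw [one_div_pow]
        field_simp
    _ = D * (N * ∑ k ∈ S.image κ, (1 / 2 : ℝ) ^ (∑ j, k j)) := by
        rw [← Finset.mul_sum]
        field_simp
    _ ≤ D * (N * (C * ((K - (n + 1) : ℕ) + 1 : ℝ) ^ n * (1 / 2) ^ (K - (n + 1)))) := by
        gcongr
    _ = D * C * ((K - (n + 1) : ℕ) + 1 : ℝ) ^ n * (N * (1 / 2) ^ (K - (n + 1))) := by ring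
    _ ≤ D * C * (Real.log (2 * N) / Real.log 2) ^ n * (2 ^ (n + 1) * 2) := by
        have h1 := hKsub.trans hKlog
        have h2 : 0 ≤ Real.log (2 * N) / Real.log 2 := le_trans (by positivity) h1
        gcongr
    _ = _ := by
        rw [div_pow]
        ring

/-! ### Sums over Frolov lattices. -/

/-- Integer points obtained by rounding along a kernel line have bounded images, so one box would
contain infinitely many of them, against the counting property. -/
theorem IsFrolovMatrix.det_ne_zero {A : Matrix (Fin d) (Fin d) ℝ} (hA : IsFrolovMatrix A) :
    A.det ≠ 0 := by
  intro hdet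
  obtain ⟨v, hv, hAv⟩ := Matrix.exists_mulVec_eq_zero_iff.2 hdet
  obtain ⟨i, hi⟩ := Function.ne_iff.1 hv
  have hi : v i ≠ 0 := hi
  -- Dividing by `v i` makes the `i`-th coordinate exactly `t`, so these points are distinct.
  set m : ℕ → Fin d → ℤ := fun t j => round ((t : ℝ) * (v j / v i)) with hm
  have hmi : ∀ t, m t i = t := fun t => by simp [hm, hi]
  have hinj : Function.Injective m := fun s t hst => by
    have := congrFun hst i
    rw [hmi, hmi] at this
    exact_mod_cast this
  set R : Fin d → ℝ := fun j => ∑ k, |A j k| + 1 with hR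
  have hRpos : ∀ j, 0 < R j := fun j => by positivity
  have hbound : ∀ t j, |latticePoint A (m t) j| ≤ R j := by
    intro t j
    have h0 : ∑ k, A j k * v k = 0 := congrFun hAv j
    have h1 : latticePoint A (m t) j = ∑ k, A j k * (m t k - t * (v k / v i)) := by
      have h2 : ∑ k, A j k * (t * (v k / v i)) = (t / v i) * ∑ k, A j k * v k := by
        rw [Finset.mul_sum]
        refine Finset.sum_congr rfl fun k _ => ?_
        field_simp
      simp only [mul_sub, Finset.sum_sub_distrib]
      rw [h2, h0, mul_zero, sub_zero]
      rfl
    rw [h1]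
    refine (Finset.abs_sum_le_sum_abs _ _).trans ?_
    have h3 : ∑ k, |A j k * (m t k - t * (v k / v i))| ≤ ∑ k, |A j k| := by
      refine Finset.sum_le_sum fun k _ => ?_
      rw [abs_mul]
      refine mul_le_of_le_one_right (abs_nonneg _) ?_
      rw [abs_sub_comm]
      exact (abs_sub_round _).trans (by norm_num)
    rw [hR]
    linarith
  obtain ⟨n, hn⟩ := exists_nat_gt (∏ j, (R j - -R j) + 1)
  have h := hA.card_le (fun j => -R j) R (fun j => by linarith [hRpos j])
    ((Finset.range n).image m) (fun x hx => by
      obtain ⟨t, -, rfl⟩ := Finset.mem_image.1 hx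
      exact ⟨fun j => (abs_le.1 (hbound t j)).1, fun j => (abs_le.1 (hbound t j)).2⟩)
  rw [Finset.card_image_of_injective _ hinj, Finset.card_range] at h
  linarith

theorem IsFrolovMatrix.one_le_prod_abs {A : Matrix (Fin d) (Fin d) ℝ} (hA : IsFrolovMatrix A)
    {m : Fin d → ℤ} (hm : m ≠ 0) : 1 ≤ ∏ j, |latticePoint A m j| := by
  rw [← Finset.abs_prod]
  exact hA.one_le_abs_prod m hm

theorem IsFrolovMatrix.latticePoint_ne_zero {A : Matrix (Fin d) (Fin d) ℝ}
    (hA : IsFrolovMatrix A) {m : Fin d → ℤ} (hm : m ≠ 0) (j : Fin d) : latticePoint A m j ≠ 0 := by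
  intro h
  have := hA.one_le_prod_abs hm
  rw [Finset.prod_eq_zero (Finset.mem_univ j) (by rw [h, abs_zero])] at this
  linarith

theorem prod_min_pow_le_prod_min_sq {b y : Fin d → ℝ} (hb : ∀ j, 0 < b j)
    (hy : 1 ≤ ∏ j, |y j|) {r : ℕ} (hr : 2 ≤ r) :
    ∏ j, (min (b j) (1 / |y j|)) ^ r ≤ ∏ j, (min (b j) (1 / |y j|)) ^ 2 := by
  have h0 : ∀ j, 0 ≤ min (b j) (1 / |y j|) := fun j => le_min (hb j).le (by positivity)
  rw [Finset.prod_pow, Finset.prod_pow]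
  refine pow_le_pow_of_le_one (Finset.prod_nonneg fun j _ => h0 j) ?_ hr
  calc ∏ j, min (b j) (1 / |y j|) ≤ ∏ j, 1 / |y j| :=
        Finset.prod_le_prod (fun j _ => h0 j) fun j _ => min_le_right _ _
    _ = 1 / ∏ j, |y j| := by simp
    _ ≤ 1 := by
        rw [div_le_one (by linarith)]
        exact hy

/-- Scaling the `j`-th axis by `b j` extracts the factor `(∏ b_j)²` and multiplies both the products
of coordinates and the volumes of boxes by `N = ∏ b_j`, which gives the hypotheses of the dyadic
estimate. -/
theorem IsFrolovMatrix.exists_sum_prod_min_le {A : Matrix (Fin d) (Fin d) ℝ}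
    (hA : IsFrolovMatrix A) (hd : 1 ≤ d) {r : ℕ} (hr : 2 ≤ r) :
    ∃ C : ℝ, 0 < C ∧ ∀ b : Fin d → ℝ, (∀ j, 0 < b j) → 1 ≤ ∏ j, b j →
      ∀ S : Finset (Fin d → ℤ), 0 ∉ S →
        ∑ m ∈ S, ∏ j, (min (b j) (1 / |latticePoint A m j|)) ^ r ≤
          C * Real.log (2 * ∏ j, b j) ^ (d - 1) := by
  obtain ⟨n, rfl⟩ := Nat.exists_eq_add_of_le' hd
  obtain ⟨C, hC, hCs⟩ := exists_sum_prod_min_sq_le n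
  refine ⟨C, hC, fun b hb hN S hS => ?_⟩
  have hne : ∀ m ∈ S, m ≠ 0 := fun m hm h => hS (h ▸ hm)
  have hmain := hCs {m : Fin (n + 1) → ℤ // m ≠ 0} (fun m j => b j * latticePoint A m j)
    (∏ j, b j) hN ?_ ?_ (S.subtype _)
  · rw [Nat.add_sub_cancel]
    refine le_trans ?_ hmain
    rw [Finset.sum_subtype_of_mem
      (fun m => ∏ j, (min 1 (1 / |b j * latticePoint A m j|)) ^ 2) hne, Finset.mul_sum]
    refine Finset.sum_le_sum fun m hm => ?_
    refine (prod_min_pow_le_prod_min_sq hb (hA.one_le_prod_abs (hne m hm)) hr).trans (le_of_eq ?_)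
    rw [← Finset.prod_pow, ← Finset.prod_mul_distrib]
    refine Finset.prod_congr rfl fun j _ => ?_
    rw [← mul_pow, mul_min_of_nonneg _ _ (hb j).le, mul_one, abs_mul, abs_of_pos (hb j)]
    have := (hb j).ne'
    have := abs_ne_zero.2 (hA.latticePoint_ne_zero (hne m hm) j)
    congr 2
    field_simp
  · rintro ⟨m, hm⟩
    simp only [abs_mul, Finset.prod_mul_distrib]
    have h1 : ∏ j, |b j| = ∏ j, b j := Finset.prod_congr rfl fun j _ => abs_of_pos (hb j)
    rw [h1]
    exact le_mul_of_one_le_right (by linarith) (hA.one_le_prod_abs hm)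
  · intro R hR T hT
    have h := hA.card_le (fun j => -(R j / b j)) (fun j => R j / b j)
      (fun j => by have := div_pos (hR j) (hb j); linarith)
      (T.map (Function.Embedding.subtype _)) (fun x hx => by
        obtain ⟨m, hm, rfl⟩ := Finset.mem_map.1 hx
        have h1 : ∀ j, |latticePoint A m j| ≤ R j / b j := fun j => by
          have h2 := hT m hm j
          rw [abs_mul, abs_of_pos (hb j)] at h2
          rw [le_div_iff₀ (hb j)]
          linarith
        exact ⟨fun j => (abs_le.1 (h1 j)).1, fun j => (abs_le.1 (h1 j)).2⟩)
    rw [Finset.card_map] at h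
    refine h.trans (le_of_eq ?_)
    rw [← Finset.prod_div_distrib]
    congr 1
    refine Finset.prod_congr rfl fun j _ => ?_
    ring

/-! ### The error of the equal-weight cubature formula. -/

/-- One bound on sums avoiding the zero frequency thus serves twice: it justifies Poisson summation
and it estimates the error. -/
theorem summable_of_sum_norm_le_of_notMem {ι : Type*} {F : ι → ℂ} {i : ι} {B : ℝ}
    (h : ∀ S : Finset ι, i ∉ S → ∑ j ∈ S, ‖F j‖ ≤ B) : Summable F := by
  classical
  refine Summable.of_norm (summable_of_sum_le (c := ‖F i‖ + B) (fun _ => norm_nonneg _) fun S => ?_)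
  calc ∑ j ∈ S, ‖F j‖ ≤ ∑ j ∈ insert i S, ‖F j‖ :=
        Finset.sum_le_sum_of_subset_of_nonneg (Finset.subset_insert _ _) fun _ _ _ => norm_nonneg _
    _ = ‖F i‖ + ∑ j ∈ (insert i S).erase i, ‖F j‖ :=
        (Finset.add_sum_erase _ _ (Finset.mem_insert_self _ _)).symm
    _ ≤ ‖F i‖ + B := by
        gcongr
        exact h _ (Finset.notMem_erase _ _)

theorem norm_sub_le_of_sum_norm_le {ι : Type*} {F : ι → ℂ} {T : ℂ} (hT : HasSum F T) {i : ι}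
    {B : ℝ} (h : ∀ S : Finset ι, i ∉ S → ∑ j ∈ S, ‖F j‖ ≤ B) : ‖T - F i‖ ≤ B := by
  classical
  refine le_of_tendsto ((Filter.Tendsto.sub_const hT (F i)).norm) ?_
  filter_upwards [Filter.eventually_ge_atTop {i}] with S hS
  have hi : i ∈ S := hS (Finset.mem_singleton_self i)
  rw [← Finset.add_sum_erase _ _ hi, add_sub_cancel_left]
  exact (norm_sum_le _ _).trans (h _ (Finset.notMem_erase _ _))

/-- The matrix generating the lattice of the Frolov point set. -/
def dualMatrix (a : ℝ) (A : Matrix (Fin d) (Fin d) ℝ) : Matrix (Fin d) (Fin d) ℝ :=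
  a⁻¹ • (A⁻¹).transpose

theorem dualMatrix_mulVec_intVec (a : ℝ) (A : Matrix (Fin d) (Fin d) ℝ) (m : Fin d → ℤ) :
    (dualMatrix a A).mulVec (intVec m) = a⁻¹ • latticePoint (A⁻¹).transpose m := by
  rw [dualMatrix, Matrix.smul_mulVec]
  rfl

theorem transpose_mulVec_dualMatrix_mulVec {a : ℝ} (ha : a ≠ 0) {A : Matrix (Fin d) (Fin d) ℝ}
    (hA : A.det ≠ 0) (x : Fin d → ℝ) :
    a • A.transpose.mulVec ((dualMatrix a A).mulVec x) = x := by
  rw [dualMatrix, Matrix.smul_mulVec, Matrix.mulVec_smul, Matrix.mulVec_mulVec, smul_smul,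
    ← Matrix.transpose_mul, Matrix.nonsing_inv_mul _ (isUnit_iff_ne_zero.2 hA)]
  simp [ha]

theorem det_dualMatrix_ne_zero {a : ℝ} (ha : a ≠ 0) {A : Matrix (Fin d) (Fin d) ℝ}
    (hA : A.det ≠ 0) : (dualMatrix a A).det ≠ 0 := by
  rw [dualMatrix, Matrix.det_smul, Matrix.det_transpose]
  refine mul_ne_zero (pow_ne_zero _ (inv_ne_zero ha)) ?_
  rw [Matrix.det_nonsing_inv, Ring.inverse_eq_inv']
  exact inv_ne_zero hA

/-- Since `a Aᵀ M = 1`, the pairing `n · x` equals `(a A n) · (M x)`. -/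
theorem mFourier_neg_toTorus {a : ℝ} (ha : a ≠ 0) {A : Matrix (Fin d) (Fin d) ℝ}
    (hA : A.det ≠ 0) (n : Fin d → ℤ) (x : Fin d → ℝ) :
    UnitAddTorus.mFourier (-n) (toTorus x) =
      ∏ j, expChar (a * latticePoint A n j) ((dualMatrix a A).mulVec x j) := by
  set z := (dualMatrix a A).mulVec x with hz
  have hx : ∀ i, x i = a * ∑ j, A j i * z j := fun i =>
    (congrFun (transpose_mulVec_dualMatrix_mulVec ha hA x) i).symm
  have hdot : ∑ i, (n i : ℝ) * x i = ∑ j, a * latticePoint A n j * z j := by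
    have h1 : ∀ j, latticePoint A n j = ∑ i, A j i * n i := fun j => rfl
    simp only [hx, h1, Finset.mul_sum, Finset.sum_mul]
    rw [Finset.sum_comm]
    refine Finset.sum_congr rfl fun j _ => Finset.sum_congr rfl fun i _ => ?_
    ring
  have h1 : UnitAddTorus.mFourier (-n) (toTorus x) =
      ∏ i, Complex.exp (-(2 * Real.pi * ((n i : ℝ) * x i) : ℝ) * Complex.I) := by
    simp only [UnitAddTorus.mFourier, ContinuousMap.coe_mk, toTorus]
    refine Finset.prod_congr rfl fun i _ => ?_
    rw [fourier_coe_apply]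
    congr 1
    push_cast [Pi.neg_apply]
    ring
  have h2 : ∀ j, expChar (a * latticePoint A n j) (z j) =
      Complex.exp (-(2 * Real.pi * (a * latticePoint A n j * z j) : ℝ) * Complex.I) := by
    intro j
    rw [expChar]
    congr 1
    push_cast
    ring
  simp only [h1, h2, ← Complex.exp_sum, ← Finset.sum_mul, Finset.sum_neg_distrib,
    ← Complex.ofReal_sum, ← Finset.mul_sum, hdot]

theorem integral_comp_mulVec {M : Matrix (Fin d) (Fin d) ℝ} (hM : M.det ≠ 0)
    {Φ : (Fin d → ℝ) → ℂ} (hΦ : Continuous Φ) :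
    ∫ x, Φ (M.mulVec x) = ((|M.det|⁻¹ : ℝ) : ℂ) * ∫ y, Φ y := by
  have h1 := Real.map_matrix_volume_pi_eq_smul_volume_pi hM
  have h2 : ∫ y, Φ y ∂(Measure.map (Matrix.toLin' M) volume) = ∫ x, Φ (M.mulVec x) :=
    integral_map (LinearMap.continuous_of_finiteDimensional _).aemeasurable
      hΦ.aestronglyMeasurable
  rw [← h2, h1, integral_smul_measure, ENNReal.toReal_ofReal (abs_nonneg _), abs_inv,
    Complex.real_smul]

/-- Lattice points outside the cube contribute nothing, and distinct integer vectors give distinct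
nodes because `M` is invertible. -/
theorem sum_frolovSet_eq_finsum {a : ℝ} (ha : a ≠ 0) {A : Matrix (Fin d) (Fin d) ℝ}
    (hA : A.det ≠ 0) {f : (Fin d → ℝ) → ℝ} (hf : ∀ x, f x ≠ 0 → x ∈ Set.Icc (0 : Fin d → ℝ) 1) :
    ∑ ξ ∈ frolovSet a A, f ξ = ∑ᶠ m : Fin d → ℤ, f ((dualMatrix a A).mulVec (intVec m)) := by
  have hinj : Function.Injective fun m : Fin d → ℤ => (dualMatrix a A).mulVec (intVec m) := by
    intro m n hmn
    have h : intVec m = intVec n := by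
      rw [← transpose_mulVec_dualMatrix_mulVec ha hA (intVec m),
        ← transpose_mulVec_dualMatrix_mulVec ha hA (intVec n)]
      exact congrArg _ (congrArg _ hmn)
    funext i
    exact Int.cast_injective (α := ℝ) (congrFun h i)
  rw [← finsum_mem_range hinj (f := f), frolovSet,
    ← finsum_mem_eq_finite_toFinset_sum f (pointSet_finite a A)]
  refine finsum_mem_inter_support_eq f _ _ ?_
  simp only [pointSet, dualMatrix_mulVec_intVec]
  ext x
  constructor
  · rintro ⟨⟨h1, -⟩, h2⟩
    exact ⟨h1, h2⟩
  · rintro ⟨h1, h2⟩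
    exact ⟨⟨h1, hf x h2⟩, h2⟩

/-- A bound for the Fourier coefficients of `h^r_B` away from the origin bounds the error of the
cubature formula on the Frolov point set with equal weights. -/
theorem abs_integral_boxHat_sub_sum_le {a : ℝ} (ha : a ≠ 0) {A : Matrix (Fin d) (Fin d) ℝ}
    (hA : A.det ≠ 0) {r : ℕ} (hr : 2 ≤ r) (B : Box d) {E : ℝ}
    (hE : ∀ S : Finset (Fin d → ℤ), 0 ∉ S → ∑ n ∈ S, ‖∫ y : Fin d → ℝ, (boxHat r B y : ℂ) *
      ∏ j, expChar (a * latticePoint A n j) (y j)‖ ≤ E) :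
    |(∫ x : Fin d → ℝ, boxHat r B x) -
      ∑ ξ ∈ frolovSet a A, |(dualMatrix a A).det| * boxHat r B ξ| ≤ E := by
  set M := dualMatrix a A with hM
  have hdet : M.det ≠ 0 := det_dualMatrix_ne_zero ha hA
  have hdetpos : 0 < |M.det| := abs_pos.2 hdet
  set g : (Fin d → ℝ) → ℂ := fun x => (boxHat r B (M.mulVec x) : ℂ) with hg
  set Φ : (Fin d → ℤ) → (Fin d → ℝ) → ℂ := fun n y =>
    (boxHat r B y : ℂ) * ∏ j, expChar (a * latticePoint A n j) (y j) with hΦ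
  have hboxcont := Complex.continuous_ofReal.comp (continuous_boxHat hr B)
  have hΦc : ∀ n, Continuous (Φ n) := fun n =>
    hboxcont.mul (continuous_finsetProd _ fun j _ => (continuous_expChar _).comp
      (continuous_apply j))
  have hMc : Continuous fun x : Fin d → ℝ => M.mulVec x :=
    Continuous.matrix_mulVec continuous_const continuous_id
  have hgc : Continuous g := hboxcont.comp hMc
  -- `x = a Aᵀ (M x)` with `M x` in the unit cube bounds `x`.
  have hgR : ∀ x, g x ≠ 0 → ∀ i, |x i| ≤ ∑ i, |a| * ∑ j, |A j i| := by
    intro x hx i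
    have h1 := mem_Icc_of_boxHat_ne_zero (by omega) B (Complex.ofReal_ne_zero.1 hx)
    have h2 : x i = a * ∑ j, A j i * M.mulVec x j :=
      (congrFun (transpose_mulVec_dualMatrix_mulVec ha hA x) i).symm
    refine le_trans ?_ (Finset.single_le_sum (f := fun i => |a| * ∑ j, |A j i|)
      (fun i _ => by positivity) (Finset.mem_univ i))
    rw [h2, abs_mul]
    refine mul_le_mul_of_nonneg_left ((Finset.abs_sum_le_sum_abs _ _).trans
      (Finset.sum_le_sum fun j _ => ?_)) (abs_nonneg a)
    rw [abs_mul]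
    refine mul_le_of_le_one_right (abs_nonneg _) ?_
    rw [abs_of_nonneg (h1.1 j)]
    exact h1.2 j
  have hcoeff : ∀ n : Fin d → ℤ, ∫ x, UnitAddTorus.mFourier (-n) (toTorus x) * g x =
      ((|M.det|⁻¹ : ℝ) : ℂ) * ∫ y, Φ n y := by
    intro n
    rw [← integral_comp_mulVec hdet (hΦc n)]
    refine integral_congr_ae (Filter.Eventually.of_forall fun x => ?_)
    simp only [hΦ, hg]
    rw [mFourier_neg_toTorus ha hA, mul_comm]
  set F : (Fin d → ℤ) → ℂ := fun n => ((|M.det|⁻¹ : ℝ) : ℂ) * ∫ y, Φ n y with hF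
  have hFE : ∀ S : Finset (Fin d → ℤ), 0 ∉ S → ∑ n ∈ S, ‖F n‖ ≤ |M.det|⁻¹ * E := by
    intro S hS
    have h1 : ∀ n, ‖F n‖ = |M.det|⁻¹ * ‖∫ y, Φ n y‖ := fun n => by
      rw [hF, norm_mul, Complex.norm_real, Real.norm_eq_abs, abs_inv, abs_abs]
    simp only [h1, ← Finset.mul_sum]
    exact mul_le_mul_of_nonneg_left (hE S hS) (by positivity)
  have hsum := hasSum_integral_mFourier hgc hgR (by
    simp only [hcoeff]
    exact summable_of_sum_norm_le_of_notMem hFE)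
  simp only [hcoeff] at hsum
  have hbound := norm_sub_le_of_sum_norm_le hsum hFE
  have hF0 : ((|M.det|⁻¹ : ℝ) : ℂ) * ∫ y, Φ 0 y =
      ((|M.det|⁻¹ * ∫ x, boxHat r B x : ℝ) : ℂ) := by
    rw [Complex.ofReal_mul, ← integral_complex_ofReal]
    congr 2
    funext y
    simp [hΦ, latticePoint, expChar, Matrix.mulVec, dotProduct]
  have hS : ∑ᶠ m : Fin d → ℤ, g (intVec m) =
      ((∑ ξ ∈ frolovSet a A, boxHat r B ξ : ℝ) : ℂ) := by
    rw [sum_frolovSet_eq_finsum ha hA (fun x hx => mem_Icc_of_boxHat_ne_zero (by omega) B hx)]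
    exact (Complex.ofRealHom.toAddMonoidHom.map_finsum_of_injective
      Complex.ofReal_injective _).symm
  rw [hS, hF0, ← Complex.ofReal_sub, Complex.norm_real, Real.norm_eq_abs,
    le_inv_mul_iff₀ hdetpos] at hbound
  rw [← Finset.mul_sum, abs_sub_comm]
  refine le_trans (le_of_eq ?_) hbound
  nth_rewrite 2 [← abs_abs M.det]
  rw [← abs_mul]
  congr 1
  field_simp

end Frolov

end

/-! ### The main estimate. -/

theorem mainTheorem10 (d : ℕ) (hd : 2 ≤ d) (A : Matrix (Fin d) (Fin d) ℝ)
    (hA : Frolov.IsFrolovMatrix A) (r : ℕ) (hr : 2 ≤ r) :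
    ∃ c : ℝ, 0 < c ∧ ∃ C : ℝ, 0 < C ∧
      ∀ a : ℝ, 1 < a → ∀ V₀ : ℝ, V₀ = c * (a ^ d)⁻¹ → ∀ V : ℝ, V₀ ≤ V →
        Frolov.optDiscrepancy r (Frolov.frolovSet a A) V ≤
          ENNReal.ofReal (C * (a ^ (r * d))⁻¹ * (Real.log (2 * V / V₀)) ^ (d - 1)) := by
  obtain ⟨C, hC, hCs⟩ := hA.exists_sum_prod_min_le (by omega) hr
  have hpi := Real.pi_pos
  have hr0 : (0 : ℝ) < r := by exact_mod_cast (by omega : 0 < r)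
  -- This `c` gives `∏ b j = V / V₀`, so that `V₀ ≤ V` is exactly the condition `1 ≤ ∏ b j` of the
  -- lattice sum.
  refine ⟨(r / Real.pi) ^ d, by positivity, C * (Real.pi ^ (r * d))⁻¹, by positivity, ?_⟩
  intro a ha V₀ hV₀ V hV
  have ha0 : 0 < a := by linarith
  -- The weight is the covolume of the node lattice, the same for all boxes.
  refine iInf_le_of_le (fun _ => |(Frolov.dualMatrix a A).det|)
    (iSup_le fun B => iSup_le fun hB => ENNReal.ofReal_le_ofReal ?_)
  refine Frolov.abs_integral_boxHat_sub_sum_le ha0.ne' hA.det_ne_zero hr B fun S hS => ?_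
  have hu : ∀ j, 0 < B.width r j := B.width_pos (by omega)
  set b : Fin d → ℝ := fun j => Real.pi * a * B.width r j with hb
  have hV₀pos : 0 < V₀ := by rw [hV₀]; positivity
  have hprod : ∏ j, b j = V / V₀ := by
    have h1 : V = r ^ d * ∏ j, B.width r j := by rw [← hB]; exact B.vol_eq (by omega)
    have h2 : ∏ j, b j = (Real.pi * a) ^ d * ∏ j, B.width r j := by
      simp [hb, Finset.prod_mul_distrib]
    rw [h2, h1, hV₀, div_pow, mul_pow]
    field_simp
  have hmain := hCs b (fun j => by have := hu j; positivity)
    (by rw [hprod, one_le_div hV₀pos]; exact hV) S hS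
  rw [hprod, ← mul_div_assoc] at hmain
  calc _ ≤ ∑ n ∈ S, ((Real.pi * a) ^ (r * d))⁻¹ *
          ∏ j, (min (b j) (1 / |Frolov.latticePoint A n j|)) ^ r := by
        refine Finset.sum_le_sum fun n hn => ?_
        have hL := hA.latticePoint_ne_zero (m := n) fun h => hS (h ▸ hn)
        refine (Frolov.norm_integral_boxHat_mul_le (by omega) B
          fun j => mul_ne_zero ha0.ne' (hL j)).trans (le_of_eq ?_)
        have h1 : ((Real.pi * a) ^ (r * d))⁻¹ = ∏ _j : Fin d, ((Real.pi * a)⁻¹) ^ r := by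
          rw [Finset.prod_const, Finset.card_univ, Fintype.card_fin, ← pow_mul, inv_pow]
        rw [h1, ← Finset.prod_mul_distrib]
        refine Finset.prod_congr rfl fun j _ => ?_
        -- Each factor is `min (u_j, 1 / (π a |L_j|)) = (π a)⁻¹ min (b_j, 1 / |L_j|)`.
        rw [← mul_pow, mul_min_of_nonneg _ _ (by positivity), abs_mul, abs_of_pos ha0]
        have := abs_ne_zero.2 (hL j)
        congr 2
        · rw [hb]; field_simp
        · field_simp
    _ ≤ ((Real.pi * a) ^ (r * d))⁻¹ * (C * Real.log (2 * V / V₀) ^ (d - 1)) := by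
        rw [← Finset.mul_sum]
        exact mul_le_mul_of_nonneg_left hmain (by positivity)
    _ = _ := by
        rw [mul_pow, mul_inv]
        ring
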